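/- Let $(W,S)$ be a Coxeter system with length function $\ell$ and Bruhat order $\le$, and let $P_{y,w}\in\mathbb Z[q]$ be its Kazhdan–Lusztig polynomials. For $y\le w$ let $\mu(y,w)$ be the coefficient of $q^{(\ell(w)-\ell(y)-1)/2}$ in $P_{y,w}$ (zero if the exponent is not a non-negative integer), and put $\tilde\mu(y,w)=\mu(y,w)$ if $y\le w$, $\tilde\mu(y,w)=\mu(w,y)$ if $w<y$, and $\tilde\mu(y,w)=0$ otherwise. Let $\tau_L(w)=\{s\in S:\ell(sw)<\ell(w)\}$ and $\tau_R(w)=\{s\in S:\ell(ws)<\ell(w)\}$. Write $x\le_R y$ if there is a sequence $x=w_1,\dots,w_n=y$ in $W$ ($n\ge 1$) with $\tilde\mu(w_i,w_{i+1})>0$ and $\tau_R(w_i)\not\subseteq\tau_R(w_{i+1})$ for $1\le i\le n-1$, and write $x\equiv_R y$ if $x\le_R y$ and $y\le_R x$. A set $D\subseteq W$ is a right KL interval set if $x,y\in D$, $w\in W$ and $x\le_R w\le_R y$ imply $w\in D$. A map $T$ from a set $D\subseteq W$ to the set of non-empty finite subsets of $W$ is right KL order preserving if for all $x,y\in D$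 with $x\le_R y$: (1) if $|T(x)|=|T(y)|=k$, then one can write $T(x)=\{x_1,\dots,x_k\}$ and $T(y)=\{y_1,\dots,y_k\}$ with $x_i\le_R y_i$ for all $i$; (2) if $|T(x)|\ne|T(y)|$, then $x'\le_R y'$ for all $x'\in T(x)$ and $y'\in T(y)$. Let $\mathcal F$ be a set of maps, each from a subset of $W$ (its domain) to the set of non-empty finite subsets of $W$. Define relations $\approx_n$ on $W$ as follows: $w_1\approx_0 w_2$ if $\tau_L(w_1)=\tau_L(w_2)$; and for $n\ge1$, $w_1\approx_n w_2$ if $w_1\approx_{n-1}w_2$ and, for every $T\in\mathcal F$ whose domain contains $w_1$, the domain of $T$ contains $w_2$ and for every $y_1\in T(w_1)$ there is $y_2\in T(w_2)$ with $y_1\approx_{n-1}y_2$, and the same holds with $w_1$ and $w_2$ interchanged. Elements $w_1,w_2$ have the same left generalized $\tau$-invariant with respect to $\mathcal F$ if $w_1\approx_n w_2$ for all $n\ge0$. Theorem. Suppose that every $T\in\mathcal F$ is right KL order preserving and that the domain of every $T\in\mathcal F$ is a right KL interval set. Let $x,y\in W$. If $x\equiv_R y$, then $x$ and $y$ have the same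 left generalized $\tau$-invariant with respect to $\mathcal F$. -/

import Mathlib

noncomputable section

open Polynomial LaurentPolynomial

namespace CoxeterSystem

variable {B : Type*} {W : Type*} [Group W] {M : CoxeterMatrix B} (cs : CoxeterSystem M W)

/-! ## Bruhat order and descent sets -/

/-- Bruhat order: `x ≤ y` iff `y` is reached from `x` by successive multiplications by
reflections, each of which increases the length. -/
def BruhatLE (x y : W) : Prop :=
  Relation.ReflTransGen
    (fun u v => ∃ t, cs.IsReflection t ∧ v = t * u ∧ cs.length u < cs.length v) x y

/-- The left descent set `τ_L(w)`, as a set of indices of simple reflections. -/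
def leftTau (w : W) : Set B := {i | cs.IsLeftDescent w i}

/-- The right descent set `τ_R(w)`, as a set of indices of simple reflections. -/
def rightTau (w : W) : Set B := {i | cs.IsRightDescent w i}

/-! ## The Hecke algebra -/

open Classical in
/-- Left multiplication by the generator `T_s` (where `s = cs.simple i`) on the free
`ℤ[q, q⁻¹]`-module with basis `(T_w)`, `w ∈ W`, where `q = T 1`: `T_s T_w = T_{sw}` if `sw > w`, and
`T_s T_w = (q - 1) T_w + q T_{sw}` if `sw < w`. -/
def heckeOp (i : B) : Module.End ℤ[T;T⁻¹] (W →₀ ℤ[T;T⁻¹]) :=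
  Finsupp.linearCombination ℤ[T;T⁻¹] fun w =>
    if cs.IsLeftDescent w i then
      Finsupp.single w (T 1 - 1) + Finsupp.single (cs.simple i * w) (T 1)
    else
      Finsupp.single (cs.simple i * w) 1

/-- The Hecke algebra of `(W, S)` over `ℤ[q, q⁻¹]`, realised in its (faithful) left regular
representation. -/
abbrev HeckeAlgebra : Subalgebra ℤ[T;T⁻¹] (Module.End ℤ[T;T⁻¹] (W →₀ ℤ[T;T⁻¹])) :=
  Algebra.adjoin ℤ[T;T⁻¹] (Set.range cs.heckeOp)

instance : Ring cs.HeckeAlgebra :=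
  @Subalgebra.toRing ℤ[T;T⁻¹] (Module.End ℤ[T;T⁻¹] (W →₀ ℤ[T;T⁻¹])) inferInstance inferInstance
    inferInstance cs.HeckeAlgebra

/-- The generator `T_s` of the Hecke algebra, for `s = cs.simple i`. -/
def heckeGen (i : B) : cs.HeckeAlgebra :=
  ⟨cs.heckeOp i, Algebra.subset_adjoin (Set.mem_range_self i)⟩

/-- The standard basis element `T_w = T_{s₁} ⋯ T_{sₖ}`, where `w = s₁ ⋯ sₖ` is a reduced
expression (the product does not depend on which one). -/
def heckeT (w : W) : cs.HeckeAlgebra :=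
  ((cs.exists_isReduced w).choose.map cs.heckeGen).prod

/-- The element `∑ a_y T_y` of the Hecke algebra. -/
def heckeSum (a : W →₀ ℤ[T;T⁻¹]) : cs.HeckeAlgebra :=
  a.sum fun y c => c • cs.heckeT y

/-- The image of `∑ a_y T_y` under the bar involution, that is, `∑ a_y(q⁻¹) (T_{y⁻¹})⁻¹`. -/
def heckeSumBar (a : W →₀ ℤ[T;T⁻¹]) : cs.HeckeAlgebra :=
  a.sum fun y c => LaurentPolynomial.invert c • Ring.inverse (cs.heckeT y⁻¹)

/-! ## Kazhdan-Lusztig polynomials -/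

/-- The conditions that characterise the polynomials `p y = P_{y,w}` for a fixed `w`. The last
condition says that `q^{-ℓ(w)/2} ∑ P_{y,w} T_y` is fixed by the bar involution. -/
structure IsKLFamily (w : W) (p : W →₀ ℤ[X]) : Prop where
  eq_zero_of_not_le : ∀ y, ¬ cs.BruhatLE y w → p y = 0
  self : p w = 1
  degree_le : ∀ y, cs.BruhatLE y w → y ≠ w →
    2 * (p y).natDegree + 1 + cs.length y ≤ cs.length w
  bar_invariant :
    cs.heckeSumBar (p.mapRange Polynomial.toLaurent (map_zero _)) =
      (T (-(cs.length w : ℤ)) : ℤ[T;T⁻¹]) •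
        cs.heckeSum (p.mapRange Polynomial.toLaurent (map_zero _))

open Classical in
/-- The Kazhdan-Lusztig polynomial `P_{y,w}`. By the theorem of Kazhdan and Lusztig there is
exactly one family as in `IsKLFamily`, so that the value `0` of the `else` branch is not used. -/
def klPoly (y w : W) : ℤ[X] :=
  if h : ∃ p : W →₀ ℤ[X], cs.IsKLFamily w p then h.choose y else 0

open Classical in
/-- `μ(y, w)`: the coefficient of `q^{(ℓ(w) - ℓ(y) - 1)/2}` in `P_{y,w}` if `y ≤ w`
(`0` if this exponent is not a natural number), and `0` if not `y ≤ w`. -/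
def klMu (y w : W) : ℤ :=
  if cs.BruhatLE y w ∧ Odd (cs.length w - cs.length y) then
    (cs.klPoly y w).coeff ((cs.length w - cs.length y - 1) / 2)
  else 0

open Classical in
/-- The symmetrised function `μ̃`. -/
def klMuTilde (y w : W) : ℤ :=
  if cs.BruhatLE y w then cs.klMu y w
  else if cs.BruhatLE w y then cs.klMu w y
  else 0

/-! ## The right preorder and right cells -/

/-- The right Kazhdan-Lusztig preorder `x ≤_R y`. -/
def RightKLLE (x y : W) : Prop :=
  Relation.ReflTransGen
    (fun u v => 0 < cs.klMuTilde u v ∧ ¬ cs.rightTau u ⊆ cs.rightTau v) x y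

/-- The equivalence relation `x ≡_R y` (being in the same right cell). -/
def RightKLEquiv (x y : W) : Prop := cs.RightKLLE x y ∧ cs.RightKLLE y x

/-- `D` is a right KL interval set. -/
def IsRightKLIntervalSet (D : Set W) : Prop :=
  ∀ x ∈ D, ∀ y ∈ D, ∀ w, cs.RightKLLE x w → cs.RightKLLE w y → w ∈ D

end CoxeterSystem

/-- A function from a subset `dom` of `W` to the power set of `W`. -/
structure PartialSetMap (W : Type*) where
  dom : Set W
  toFun : dom → Set W

namespace CoxeterSystem

variable {B : Type*} {W : Type*} [Group W] {M : CoxeterMatrix B} (cs : CoxeterSystem M W)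

/-- `T` is right KL order preserving: if `x ≤_R y` in the domain, then
(1) if `|T(x)| = |T(y)| = k`, one can write `T(x) = {x₁, …, xₖ}` and `T(y) = {y₁, …, yₖ}` with
`xᵢ ≤_R yᵢ` for all `i`; (2) if `|T(x)| ≠ |T(y)|`, every element of `T(x)` is `≤_R` every element
of `T(y)`. -/
def IsRightKLOrderPreserving (T : PartialSetMap W) : Prop :=
  ∀ x y : T.dom, cs.RightKLLE (x : W) (y : W) →
    (∀ k : ℕ, (T.toFun x).encard = k → (T.toFun y).encard = k →
      ∃ a b : Fin k → W, Set.range a = T.toFun x ∧ Set.range b = T.toFun y ∧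
        ∀ i, cs.RightKLLE (a i) (b i)) ∧
    ((T.toFun x).encard ≠ (T.toFun y).encard →
      ∀ a ∈ T.toFun x, ∀ b ∈ T.toFun y, cs.RightKLLE a b)

/-- Left equivalence to order `n` with respect to the set `F` of set-valued maps. -/
def LeftGenTauEquiv (F : Set (PartialSetMap W)) : ℕ → W → W → Prop
  | 0, x, y => cs.leftTau x = cs.leftTau y
  | n + 1, x, y =>
    LeftGenTauEquiv F n x y ∧
    (∀ T ∈ F, ∀ hx : x ∈ T.dom, ∃ hy : y ∈ T.dom,
      ∀ a ∈ T.toFun ⟨x, hx⟩, ∃ b ∈ T.toFun ⟨y, hy⟩, LeftGenTauEquiv F n a b) ∧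
    (∀ T ∈ F, ∀ hy : y ∈ T.dom, ∃ hx : x ∈ T.dom,
      ∀ b ∈ T.toFun ⟨y, hy⟩, ∃ a ∈ T.toFun ⟨x, hx⟩, LeftGenTauEquiv F n b a)

/-- `x` and `y` have the same left generalized `τ`-invariant with respect to `F`. -/
def SameLeftGenTau (F : Set (PartialSetMap W)) (x y : W) : Prop :=
  ∀ n, cs.LeftGenTauEquiv F n x y

end CoxeterSystem

end

/-!
The heart of the matter is that `x ≤_R y` implies `τ_L(y) ⊆ τ_L(x)`
(`CoxeterSystem.RightKLLE.leftTau_subset`), so that elements of a right cell have the same left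
descent set. The rest is an induction on the order `n` of the invariant: a set-valued map that
preserves `≤_R` takes two elements of a cell to sets whose elements are pairwise in a common cell
(`CoxeterSystem.IsRightKLOrderPreserving.exists_rightKLEquiv`), and its domain, being an interval
set, is a union of cells.

The inclusion of descent sets rests on the property `P_{su,w} = P_{u,w}` if `sw < w`, and its mirror
image for multiplication on the right (`CoxeterSystem.IsKLFamily.apply_step_eq`): by the degree
bound, it forces `v = su` as soon as `μ(u, v) ≠ 0`, `sv < v` and `su > u`. This property is
derived here from the defining conditions of the family `(P_{y,w})` alone. With `C = ∑ P_{y,w} T_y`,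
the element `(T_s - q) C` is invariant under the bar involution up to the factor `q^{-ℓ(w)-1}`, and
its coefficient at a longest element of its support would be a palindromic polynomial of too small
a degree. The existence of Kazhdan-Lusztig polynomials is not needed, since `μ` is zero where there
is no such family, and neither is any property of the Bruhat order.

For this argument the elements `T_w` must form a basis of the Hecke algebra on which the generators
act by the usual formulas from both sides. As the algebra is given by operators of left
multiplication, it suffices that these commute with the operators of right multiplication
(`CoxeterSystem.heckeOp_heckeOpRight`); an element is then determined by its value at `T_1`. The
commutation comes from the exchange condition, which is proved with the action of `W` on
`W × ℤ/2` that records the parity of inversions.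
-/

noncomputable section

open Polynomial LaurentPolynomial

namespace CoxeterSystem

variable {B : Type*} {W : Type*} [Group W] {M : CoxeterMatrix B} (cs : CoxeterSystem M W)

/-! ### The exchange condition -/

theorem endMul_apply {X : Type*} (f g : Function.End X) (p : X) : (f * g) p = f (g p) := rfl

open Classical in
/-- The action of a simple reflection `s` on `W × ℤ/2`: conjugation by `s` on the first component,
and a change of sign in the second component exactly when the first one is `s`. (The usual action
is on pairs whose first component is a reflection; allowing all of `W` is harmless.) -/
def reflStep (i : B) : Function.End (W × ZMod 2) := fun p =>
  (cs.simple i * p.1 * cs.simple i, p.2 + if p.1 = cs.simple i then 1 else 0)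

open Classical in
theorem reflStep_mul_pow (i j : B) (n : ℕ) (t : W) (e : ZMod 2) :
    ((cs.reflStep i * cs.reflStep j) ^ n) (t, e) =
      ((cs.simple i * cs.simple j) ^ n * t * ((cs.simple i * cs.simple j) ^ n)⁻¹,
        e + ∑ k ∈ Finset.range (2 * n),
          if t = (cs.simple j * cs.simple i) ^ k * cs.simple j then 1 else 0) := by
  set x := cs.simple i * cs.simple j with hx
  have hx' : cs.simple j * cs.simple i = x⁻¹ := by simp [hx]
  have hsemi (k : ℕ) : cs.simple j * x ^ k = (x⁻¹) ^ k * cs.simple j := by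
    have h : SemiconjBy (cs.simple j) x x⁻¹ := by
      simp [SemiconjBy, hx, mul_assoc]
    exact h.pow_right k
  induction n with
  | zero => simp [Function.End.one_def]
  | succ n ih =>
    rw [pow_succ', endMul_apply, ih, endMul_apply]
    have h1 : x ^ n * t * (x ^ n)⁻¹ = cs.simple j ↔ t = (x⁻¹) ^ (2 * n) * cs.simple j := by
      rw [mul_inv_eq_iff_eq_mul, hsemi, ← eq_inv_mul_iff_mul_eq, two_mul, pow_add, inv_pow,
        mul_assoc]
    have h2 : cs.simple j * (x ^ n * t * (x ^ n)⁻¹) * cs.simple j = cs.simple i ↔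
        t = (x⁻¹) ^ (2 * n + 1) * cs.simple j := by
      have : cs.simple j * (x ^ n * t * (x ^ n)⁻¹) * cs.simple j = cs.simple i ↔
          x ^ n * t * (x ^ n)⁻¹ = x⁻¹ * cs.simple j := by
        rw [← hx']
        constructor
        · intro h
          rw [← h]
          simp [mul_assoc]
        · intro h
          rw [h]
          simp [mul_assoc]
      rw [this, mul_inv_eq_iff_eq_mul, mul_assoc, hsemi, ← eq_inv_mul_iff_mul_eq, ← mul_assoc,
        ← mul_assoc, ← inv_pow]
      rw [show 2 * n + 1 = n + 1 + n by ring, pow_add, pow_succ]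
    rw [show 2 * (n + 1) = 2 * n + 1 + 1 by ring, Finset.sum_range_succ, Finset.sum_range_succ]
    simp only [reflStep, hx', Prod.mk.injEq, h1, h2]
    refine ⟨?_, by ring⟩
    rw [pow_succ' x n, hx]
    simp [mul_assoc]

theorem isLiftable_reflStep : M.IsLiftable cs.reflStep := by
  classical
  intro i j
  funext ⟨t, e⟩
  rw [reflStep_mul_pow]
  have hper (k : ℕ) : (cs.simple j * cs.simple i) ^ (M i j + k) =
      (cs.simple j * cs.simple i) ^ k := by
    rw [pow_add, cs.simple_mul_simple_pow', one_mul]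
  -- the sum runs over two periods, so it vanishes modulo 2
  rw [two_mul, Finset.sum_range_add]
  simp only [hper, cs.simple_mul_simple_pow, CharTwo.add_self_eq_zero]
  simp [Function.End.one_def]

/-- The action of `W` on `W × ℤ/2` that extends `reflStep`. -/
def reflAction : W →* Function.End (W × ZMod 2) := cs.lift ⟨cs.reflStep, cs.isLiftable_reflStep⟩

open Classical in
/-- The parity of the multiplicity of `t` in the inversion sequence of a word depends only on the
product of the word, since it is read off from the action of that product. -/
theorem reflAction_wordProd (ω : List B) (t : W) (e : ZMod 2) :
    cs.reflAction (cs.wordProd ω) (t, e) =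
      (cs.wordProd ω * t * (cs.wordProd ω)⁻¹, e + ((cs.rightInvSeq ω).count t : ZMod 2)) := by
  induction ω with
  | nil => simp [Function.End.one_def]
  | cons i ω ih =>
    rw [wordProd_cons, map_mul, endMul_apply, ih]
    have h : cs.reflAction (cs.simple i) = cs.reflStep i := cs.lift_apply_simple _ i
    have h1 : cs.wordProd ω * t * (cs.wordProd ω)⁻¹ = cs.simple i ↔
        (cs.wordProd ω)⁻¹ * cs.simple i * cs.wordProd ω = t := by
      constructor
      · intro h; rw [← h]; group
      · intro h; rw [← h]; group
    rw [h, rightInvSeq, List.count_cons]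
    simp only [reflStep, h1, beq_iff_eq, Prod.mk.injEq]
    refine ⟨by simp [mul_assoc], ?_⟩
    push_cast
    ring

/-- A right descent of `w` occurs in the inversion sequence of every word for `w`. -/
theorem IsRightDescent.simple_mem_rightInvSeq {ω : List B} {i : B}
    (h : cs.IsRightDescent (cs.wordProd ω) i) : cs.simple i ∈ cs.rightInvSeq ω := by
  classical
  -- compare with a reduced word for `w` that ends in `s`, where `s` has multiplicity one
  obtain ⟨ω', hω', he⟩ := cs.exists_isReduced (cs.wordProd ω * cs.simple i)
  have hprod : cs.wordProd (ω'.concat i) = cs.wordProd ω := by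
    rw [wordProd_concat, ← he]; simp
  have hred : cs.IsReduced (ω'.concat i) := by
    have := cs.isRightDescent_iff.1 h
    rw [he, hω'.eq] at this
    rw [IsReduced, hprod, ← this]; simp
  have hmem : cs.simple i ∈ cs.rightInvSeq (ω'.concat i) := by
    rw [rightInvSeq_concat]; simp
  have hcount := List.count_eq_one_of_mem hred.nodup_rightInvSeq hmem
  have h1 := cs.reflAction_wordProd (ω'.concat i) (cs.simple i) 0
  have h2 := cs.reflAction_wordProd ω (cs.simple i) 0
  rw [hprod, h2, Prod.mk.injEq, hcount] at h1
  by_contra hn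
  rw [List.count_eq_zero_of_not_mem hn] at h1
  simp at h1

/-- If the step from `w` to `sw` creates the right descent `t`, then `t` must be the one inversion
that a word for `sw` has in addition to those of `w`, namely `w⁻¹sw`. -/
theorem simple_mul_eq_mul_simple {w : W} {i j : B} (hj : ¬ cs.IsRightDescent w j)
    (hij : cs.IsRightDescent (cs.simple i * w) j) :
    cs.simple i * w = w * cs.simple j := by
  obtain ⟨ω, hω, rfl⟩ := cs.exists_isReduced w
  rw [← wordProd_cons] at hij
  have hmem := IsRightDescent.simple_mem_rightInvSeq cs hij
  rw [rightInvSeq, List.mem_cons] at hmem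
  rcases hmem with h | h
  · rw [h]; group
  · exact absurd (cs.isRightInversion_of_mem_rightInvSeq hω h).2 hj

/-- Left multiplication by `s` preserves the property of `t` to be a right descent, and right
multiplication by `t` the property of `s` to be a left descent, except if `sw = wt`. -/
theorem simple_mul_eq_or_descent_iff (w : W) (i j : B) :
    cs.simple i * w = w * cs.simple j ∨
      ((cs.IsRightDescent (cs.simple i * w) j ↔ cs.IsRightDescent w j) ∧
        (cs.IsLeftDescent (w * cs.simple j) i ↔ cs.IsLeftDescent w i)) := by
  by_cases hne : cs.simple i * w = w * cs.simple j
  · exact Or.inl hne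
  refine Or.inr ?_
  have h1 := cs.simple_mul_eq_mul_simple (w := w) (i := i) (j := j)
  have h2 := cs.simple_mul_eq_mul_simple (w := cs.simple i * w) (i := i) (j := j)
  have hne2 : cs.simple i * (cs.simple i * w) ≠ cs.simple i * w * cs.simple j := by
    intro h
    apply hne
    rw [mul_assoc] at h
    exact mul_left_cancel h
  rw [imp_iff_not hne] at *
  have h2' : ¬ cs.IsRightDescent (cs.simple i * w) j → ¬ cs.IsRightDescent w j := by
    intro h h'
    exact hne2 (h2 h (by simpa using h'))
  have a1 := cs.length_simple_mul w i
  have a2 := cs.length_mul_simple w j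
  have a3 := cs.length_simple_mul (w * cs.simple j) i
  have a4 := cs.length_mul_simple (cs.simple i * w) j
  rw [← mul_assoc] at a3
  simp only [IsRightDescent, IsLeftDescent, ← mul_assoc] at *
  omega

/-! ### Left and right multiplication operators -/

/-- A map `σ : W → W` which, like the multiplication by a simple reflection on either side, is an
involution that changes the length by one. Arguments that work for both sides are stated for
such a map. -/
structure IsLengthStep (σ : W → W) : Prop where
  invol : ∀ w, σ (σ w) = w
  length_step : ∀ w, cs.length (σ w) = cs.length w + 1 ∨ cs.length (σ w) + 1 = cs.length w

theorem isLengthStep_simple_mul (i : B) : cs.IsLengthStep (fun w => cs.simple i * w) :=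
  ⟨fun _ => cs.simple_mul_simple_cancel_left i, fun w => cs.length_simple_mul w i⟩

theorem isLengthStep_mul_simple (i : B) : cs.IsLengthStep (fun w => w * cs.simple i) :=
  ⟨fun _ => cs.simple_mul_simple_cancel_right i, fun w => cs.length_mul_simple w i⟩

variable {cs} in
theorem IsLengthStep.length_lt_iff {σ : W → W} (hσ : cs.IsLengthStep σ) (w : W) :
    cs.length (σ (σ w)) < cs.length (σ w) ↔ ¬ cs.length (σ w) < cs.length w := by
  rw [hσ.invol]
  have := hσ.length_step w
  omega

open Classical in
/-- The operator given by the formula of multiplication by `T_s`, with `σ` in place of the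
multiplication by `s`. -/
def stepOp (σ : W → W) : Module.End ℤ[T;T⁻¹] (W →₀ ℤ[T;T⁻¹]) :=
  Finsupp.linearCombination ℤ[T;T⁻¹] fun w =>
    if cs.length (σ w) < cs.length w then
      Finsupp.single w (T 1 - 1) + Finsupp.single (σ w) (T 1)
    else
      Finsupp.single (σ w) 1

theorem heckeOp_eq_stepOp (i : B) : cs.heckeOp i = cs.stepOp (fun w => cs.simple i * w) := by
  refine Finsupp.lhom_ext' fun w => LinearMap.ext_ring ?_
  simp [heckeOp, stepOp, IsLeftDescent]

/-- Right multiplication by the generator `T_s` on the free module with basis `(T_w)`. -/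
def heckeOpRight (i : B) : Module.End ℤ[T;T⁻¹] (W →₀ ℤ[T;T⁻¹]) :=
  cs.stepOp (fun w => w * cs.simple i)

theorem stepOp_single_of_lt {σ : W → W} {w : W} (h : cs.length (σ w) < cs.length w)
    (c : ℤ[T;T⁻¹]) :
    cs.stepOp σ (Finsupp.single w c) =
      Finsupp.single w (c * (T 1 - 1)) + Finsupp.single (σ w) (c * T 1) := by
  simp only [stepOp, Finsupp.linearCombination_single, if_pos h, smul_add, Finsupp.smul_single,
    smul_eq_mul]

theorem stepOp_single_of_not_lt {σ : W → W} {w : W} (h : ¬ cs.length (σ w) < cs.length w)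
    (c : ℤ[T;T⁻¹]) :
    cs.stepOp σ (Finsupp.single w c) = Finsupp.single (σ w) c := by
  simp [stepOp, h, Finsupp.smul_single]

theorem heckeOp_single_of_isLeftDescent {w : W} {i : B} (h : cs.IsLeftDescent w i)
    (c : ℤ[T;T⁻¹]) :
    cs.heckeOp i (Finsupp.single w c) =
      Finsupp.single w (c * (T 1 - 1)) + Finsupp.single (cs.simple i * w) (c * T 1) := by
  rw [heckeOp_eq_stepOp, cs.stepOp_single_of_lt h]

theorem heckeOp_single_of_not_isLeftDescent {w : W} {i : B} (h : ¬ cs.IsLeftDescent w i)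
    (c : ℤ[T;T⁻¹]) :
    cs.heckeOp i (Finsupp.single w c) = Finsupp.single (cs.simple i * w) c := by
  rw [heckeOp_eq_stepOp, cs.stepOp_single_of_not_lt h]

theorem heckeOpRight_single_of_isRightDescent {w : W} {i : B} (h : cs.IsRightDescent w i)
    (c : ℤ[T;T⁻¹]) :
    cs.heckeOpRight i (Finsupp.single w c) =
      Finsupp.single w (c * (T 1 - 1)) + Finsupp.single (w * cs.simple i) (c * T 1) := by
  rw [heckeOpRight, cs.stepOp_single_of_lt (σ := fun w => w * cs.simple i) h]

theorem heckeOpRight_single_of_not_isRightDescent {w : W} {i : B} (h : ¬ cs.IsRightDescent w i)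
    (c : ℤ[T;T⁻¹]) :
    cs.heckeOpRight i (Finsupp.single w c) = Finsupp.single (w * cs.simple i) c := by
  rw [heckeOpRight, cs.stepOp_single_of_not_lt (σ := fun w => w * cs.simple i) h]

section stepOp

variable {cs} {σ : W → W} (hσ : cs.IsLengthStep σ)
include hσ

open Classical in
theorem IsLengthStep.stepOp_apply (v : W →₀ ℤ[T;T⁻¹]) (z : W) :
    cs.stepOp σ v z = if cs.length (σ z) < cs.length z then v (σ z) + (T 1 - 1) * v z
      else T 1 * v (σ z) := by
  induction v using Finsupp.induction_linear with
  | zero => simp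
  | add f g hf hg =>
    rw [map_add, Finsupp.add_apply, hf, hg]
    split_ifs <;> simp only [Finsupp.add_apply] <;> ring
  | single w c =>
    have hlt := hσ.length_lt_iff w
    have hne : σ w ≠ w := fun h => by
      have := hσ.length_step w
      rw [h] at this
      omega
    have hz : σ z = w ↔ z = σ w := ⟨fun h => by rw [← h, hσ.invol], fun h => by rw [h, hσ.invol]⟩
    have hstep := hσ.length_step w
    by_cases h : cs.length (σ w) < cs.length w
    · rw [cs.stepOp_single_of_lt h]
      by_cases h1 : z = w
      · subst h1
        simp [h, hne]
        ring
      · by_cases h2 : z = σ w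
        · subst h2
          have h3 : ¬ cs.length w < cs.length (σ w) := by omega
          simp [hσ.invol, hne.symm, h3, mul_comm]
        · simp [Ne.symm h1, hz, h2]
    · rw [cs.stepOp_single_of_not_lt h]
      by_cases h1 : z = w
      · subst h1
        simp [h, hne]
      · by_cases h2 : z = σ w
        · subst h2
          have h3 : cs.length w < cs.length (σ w) := by omega
          simp [hσ.invol, hne.symm, h3]
        · simp [Ne.symm h1, hz, h2]

/-- The quadratic relation. -/
theorem IsLengthStep.stepOp_stepOp (v : W →₀ ℤ[T;T⁻¹]) :
    cs.stepOp σ (cs.stepOp σ v) = (T 1 - 1 : ℤ[T;T⁻¹]) • cs.stepOp σ v + (T 1 : ℤ[T;T⁻¹]) • v := by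
  ext1 z
  have h := hσ.length_lt_iff z
  rw [hσ.stepOp_apply, Finsupp.add_apply, Finsupp.smul_apply, Finsupp.smul_apply,
    hσ.stepOp_apply, hσ.stepOp_apply]
  by_cases hz : cs.length (σ z) < cs.length z
  · rw [if_pos hz, if_neg (by tauto), hσ.invol, smul_eq_mul, smul_eq_mul]
    ring
  · rw [if_neg hz, if_pos (by tauto), if_neg hz, hσ.invol, smul_eq_mul, smul_eq_mul]
    ring

end stepOp

theorem heckeOp_heckeOpRight (i j : B) (v : W →₀ ℤ[T;T⁻¹]) :
    cs.heckeOp i (cs.heckeOpRight j v) = cs.heckeOpRight j (cs.heckeOp i v) := by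
  induction v using Finsupp.induction_linear with
  | zero => simp
  | add f g hf hg => simp only [map_add, hf, hg]
  | single w c =>
    rcases cs.simple_mul_eq_or_descent_iff w i j with h | ⟨h1, h2⟩
    · -- If `sw = wt`, both operators agree on the span of `T_w` and `T_{sw}`.
      have key {w : W} (h : cs.simple i * w = w * cs.simple j) (c : ℤ[T;T⁻¹]) :
          cs.heckeOp i (Finsupp.single w c) = cs.heckeOpRight j (Finsupp.single w c) := by
        by_cases hi : cs.IsLeftDescent w i
        · rw [cs.heckeOp_single_of_isLeftDescent hi,
            cs.heckeOpRight_single_of_isRightDescent (by rwa [IsRightDescent, ← h]), h]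
        · rw [cs.heckeOp_single_of_not_isLeftDescent hi,
            cs.heckeOpRight_single_of_not_isRightDescent (by rwa [IsRightDescent, ← h]), h]
      have h' : cs.simple i * (w * cs.simple j) = w * cs.simple j * cs.simple j := by
        rw [← h, simple_mul_simple_cancel_left, h, simple_mul_simple_cancel_right]
      rw [key h]
      by_cases hj : cs.IsRightDescent w j
      · rw [cs.heckeOpRight_single_of_isRightDescent hj, map_add, map_add, key h, key h']
      · rw [cs.heckeOpRight_single_of_not_isRightDescent hj, key h']
    · by_cases hi : cs.IsLeftDescent w i <;> by_cases hj : cs.IsRightDescent w j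
      · rw [cs.heckeOp_single_of_isLeftDescent hi, cs.heckeOpRight_single_of_isRightDescent hj]
        simp only [map_add]
        rw [cs.heckeOp_single_of_isLeftDescent hi, cs.heckeOp_single_of_isLeftDescent (h2.2 hi),
          cs.heckeOpRight_single_of_isRightDescent hj,
          cs.heckeOpRight_single_of_isRightDescent (h1.2 hj), mul_assoc (cs.simple i)]
        simp only [mul_right_comm _ (T 1)]
        abel
      · rw [cs.heckeOp_single_of_isLeftDescent hi, cs.heckeOpRight_single_of_not_isRightDescent hj]
        simp only [map_add]
        rw [cs.heckeOp_single_of_isLeftDescent (h2.2 hi),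
          cs.heckeOpRight_single_of_not_isRightDescent hj,
          cs.heckeOpRight_single_of_not_isRightDescent (mt h1.1 hj), mul_assoc (cs.simple i)]
      · rw [cs.heckeOp_single_of_not_isLeftDescent hi, cs.heckeOpRight_single_of_isRightDescent hj]
        simp only [map_add]
        rw [cs.heckeOp_single_of_not_isLeftDescent hi,
          cs.heckeOp_single_of_not_isLeftDescent (mt h2.1 hi),
          cs.heckeOpRight_single_of_isRightDescent (h1.2 hj), mul_assoc (cs.simple i)]
      · rw [cs.heckeOp_single_of_not_isLeftDescent hi,
          cs.heckeOpRight_single_of_not_isRightDescent hj,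
          cs.heckeOp_single_of_not_isLeftDescent (mt h2.1 hi),
          cs.heckeOpRight_single_of_not_isRightDescent (mt h1.1 hj), mul_assoc (cs.simple i)]

/-! ### The standard basis of the Hecke algebra -/

theorem heckeAlgebra_apply_heckeOpRight (h : cs.HeckeAlgebra) (j : B) (v : W →₀ ℤ[T;T⁻¹]) :
    (h : Module.End ℤ[T;T⁻¹] (W →₀ ℤ[T;T⁻¹])) (cs.heckeOpRight j v) =
      cs.heckeOpRight j ((h : Module.End ℤ[T;T⁻¹] (W →₀ ℤ[T;T⁻¹])) v) := by
  obtain ⟨h, hh⟩ := h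
  simp only
  induction hh using Algebra.adjoin_induction generalizing v with
  | mem x hx =>
    obtain ⟨i, rfl⟩ := hx
    exact cs.heckeOp_heckeOpRight i j v
  | algebraMap r => simp
  | add x y _ _ hx hy => simp [hx, hy]
  | mul x y _ _ hx hy => simp [hx, hy]

/-- The value of an element of the Hecke algebra (an operator) at the basis vector `T_1`, that is,
its coordinates in the basis `(T_w)`. -/
def evalOne : cs.HeckeAlgebra →ₗ[ℤ[T;T⁻¹]] (W →₀ ℤ[T;T⁻¹]) where
  toFun h := (h : Module.End ℤ[T;T⁻¹] (W →₀ ℤ[T;T⁻¹])) (Finsupp.single 1 1)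
  map_add' _ _ := rfl
  map_smul' _ _ := rfl

theorem evalOne_one : cs.evalOne 1 = Finsupp.single 1 1 := rfl

theorem evalOne_mul (h k : cs.HeckeAlgebra) :
    cs.evalOne (h * k) = (h : Module.End ℤ[T;T⁻¹] (W →₀ ℤ[T;T⁻¹])) (cs.evalOne k) := rfl

theorem evalOne_gen_mul (i : B) (k : cs.HeckeAlgebra) :
    cs.evalOne (cs.heckeGen i * k) = cs.heckeOp i (cs.evalOne k) := rfl

theorem evalOne_mul_gen (i : B) (h : cs.HeckeAlgebra) :
    cs.evalOne (h * cs.heckeGen i) = cs.heckeOpRight i (cs.evalOne h) := by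
  have h1 : cs.evalOne (cs.heckeGen i) = cs.heckeOpRight i (Finsupp.single 1 1) := by
    change cs.heckeOp i (Finsupp.single 1 1) = _
    rw [heckeOp_single_of_not_isLeftDescent _ (cs.not_isLeftDescent_one i),
      heckeOpRight_single_of_not_isRightDescent _ (cs.not_isRightDescent_one i), one_mul, mul_one]
  rw [evalOne_mul, h1, heckeAlgebra_apply_heckeOpRight]
  rfl

/-- An operator in the Hecke algebra is determined by its value at `T_1`, as it commutes with the
right multiplications. -/
theorem evalOne_injective : Function.Injective cs.evalOne := by
  intro h k hk
  have key : ∀ n w, cs.length w = n →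
      (h : Module.End ℤ[T;T⁻¹] (W →₀ ℤ[T;T⁻¹])) (Finsupp.single w 1) =
      (k : Module.End ℤ[T;T⁻¹] (W →₀ ℤ[T;T⁻¹])) (Finsupp.single w 1) := by
    intro n
    induction n with
    | zero =>
      intro w hw
      rw [cs.length_eq_zero_iff.1 hw]
      exact hk
    | succ n ih =>
      intro w hw
      have hw1 : w ≠ 1 := fun h => by simp [h] at hw
      obtain ⟨j, hj⟩ := cs.exists_rightDescent_of_ne_one hw1
      have hj' := cs.isRightDescent_iff.1 hj
      have he : Finsupp.single w (1 : ℤ[T;T⁻¹]) =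
          cs.heckeOpRight j (Finsupp.single (w * cs.simple j) 1) := by
        rw [heckeOpRight_single_of_not_isRightDescent, simple_mul_simple_cancel_right]
        rwa [← isRightDescent_iff_not_isRightDescent_mul]
      rw [he, heckeAlgebra_apply_heckeOpRight, heckeAlgebra_apply_heckeOpRight, ih _ (by omega)]
  refine Subtype.ext (Finsupp.lhom_ext' fun w => LinearMap.ext_ring ?_)
  exact key _ w rfl

theorem evalOne_heckeT (w : W) : cs.evalOne (cs.heckeT w) = Finsupp.single w 1 := by
  have key : ∀ ω : List B, cs.IsReduced ω →
      cs.evalOne (ω.map cs.heckeGen).prod = Finsupp.single (cs.wordProd ω) 1 := by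
    intro ω
    induction ω with
    | nil => intro _; simp [evalOne_one]
    | cons i ω ih =>
      intro hω
      have hω' : cs.IsReduced ω := hω.drop 1
      rw [List.map_cons, List.prod_cons, evalOne_gen_mul, ih hω',
        heckeOp_single_of_not_isLeftDescent, wordProd_cons]
      have h1 := hω.eq
      rw [wordProd_cons] at h1
      rw [IsLeftDescent, h1, hω'.eq]
      simp
  have h := (cs.exists_isReduced w).choose_spec
  rw [heckeT, key _ h.1, ← h.2]

theorem heckeT_one : cs.heckeT 1 = 1 := by
  apply cs.evalOne_injective
  rw [evalOne_heckeT, evalOne_one]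

theorem heckeT_simple_mul {w : W} {i : B} (h : ¬ cs.IsLeftDescent w i) :
    cs.heckeT (cs.simple i * w) = cs.heckeGen i * cs.heckeT w := by
  apply cs.evalOne_injective
  rw [evalOne_gen_mul, evalOne_heckeT, evalOne_heckeT, heckeOp_single_of_not_isLeftDescent _ h]

theorem heckeT_mul_simple {w : W} {i : B} (h : ¬ cs.IsRightDescent w i) :
    cs.heckeT (w * cs.simple i) = cs.heckeT w * cs.heckeGen i := by
  apply cs.evalOne_injective
  rw [evalOne_mul_gen, evalOne_heckeT, evalOne_heckeT, 
    heckeOpRight_single_of_not_isRightDescent _ h]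

theorem evalOne_heckeSum (a : W →₀ ℤ[T;T⁻¹]) : cs.evalOne (cs.heckeSum a) = a := by
  rw [heckeSum, Finsupp.sum, map_sum]
  simp only [map_smul, evalOne_heckeT, Finsupp.smul_single, smul_eq_mul, mul_one]
  exact a.sum_single

/-- The inverse `q⁻¹ T_s + (q⁻¹ - 1)` of the generator `T_s`. -/
def heckeGenInv (i : B) : cs.HeckeAlgebra :=
  (T (-1) : ℤ[T;T⁻¹]) • cs.heckeGen i + (T (-1) - 1 : ℤ[T;T⁻¹]) • 1

theorem heckeGen_mul_self (i : B) :
    cs.heckeGen i * cs.heckeGen i =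
      (T 1 - 1 : ℤ[T;T⁻¹]) • cs.heckeGen i + (T 1 : ℤ[T;T⁻¹]) • 1 := by
  apply cs.evalOne_injective
  have h1 : cs.evalOne (cs.heckeGen i) = cs.heckeOp i (Finsupp.single 1 1) := rfl
  rw [evalOne_gen_mul, map_add, map_smul, map_smul, h1, evalOne_one, heckeOp_eq_stepOp,
    (cs.isLengthStep_simple_mul i).stepOp_stepOp]

theorem T_neg_one_mul_T_one : (T (-1) * T 1 : ℤ[T;T⁻¹]) = 1 := by
  rw [← T_add]; simp

theorem heckeGen_mul_inv (i : B) : cs.heckeGen i * cs.heckeGenInv i = 1 := by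
  have h := T_neg_one_mul_T_one
  rw [heckeGenInv, mul_add, mul_smul_comm, mul_smul_comm, heckeGen_mul_self, mul_one, smul_add,
    smul_smul, smul_smul, h, mul_sub, h, one_smul, mul_one, add_right_comm, ← add_smul]
  simp

theorem heckeGen_inv_mul (i : B) : cs.heckeGenInv i * cs.heckeGen i = 1 := by
  rw [← cs.heckeGen_mul_inv i, heckeGenInv, mul_add, add_mul]
  simp

theorem heckeGenInv_mul_self (i : B) :
    cs.heckeGenInv i * cs.heckeGenInv i =
      (T (-1) - 1 : ℤ[T;T⁻¹]) • cs.heckeGenInv i + (T (-1) : ℤ[T;T⁻¹]) • 1 := by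
  nth_rw 1 [heckeGenInv]
  rw [add_mul, smul_mul_assoc, smul_mul_assoc, heckeGen_mul_inv, one_mul, add_comm]

theorem isUnit_heckeGen (i : B) : IsUnit (cs.heckeGen i) :=
  ⟨⟨cs.heckeGen i, cs.heckeGenInv i, cs.heckeGen_mul_inv i, cs.heckeGen_inv_mul i⟩, rfl⟩

theorem isUnit_heckeT (w : W) : IsUnit (cs.heckeT w) := by
  rw [heckeT]
  generalize (cs.exists_isReduced w).choose = ω
  induction ω with
  | nil => simp
  | cons i ω ih =>
    rw [List.map_cons, List.prod_cons]
    exact (cs.isUnit_heckeGen i).mul ih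

/-! ### The bar involution -/

theorem heckeSumBar_add (a b : W →₀ ℤ[T;T⁻¹]) :
    cs.heckeSumBar (a + b) = cs.heckeSumBar a + cs.heckeSumBar b := by
  rw [heckeSumBar, Finsupp.sum_add_index']
  · rfl
  · simp
  · intro w c d
    rw [map_add, add_smul]

theorem heckeSumBar_zero : cs.heckeSumBar 0 = 0 := by
  rw [heckeSumBar, Finsupp.sum_zero_index]

theorem heckeSumBar_single (w : W) (c : ℤ[T;T⁻¹]) :
    cs.heckeSumBar (Finsupp.single w c) = invert c • Ring.inverse (cs.heckeT w⁻¹) := by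
  rw [heckeSumBar, Finsupp.sum_single_index]
  simp

theorem ringInverse_mul {R : Type*} [Ring R] {x y x' : R} (hy : IsUnit y) (h : x * x' = 1)
    (h' : x' * x = 1) :
    Ring.inverse (x * y) = Ring.inverse y * x' := by
  obtain ⟨u, rfl⟩ := hy
  have := Ring.inverse_unit (⟨x, x', h, h'⟩ * u)
  rw [Units.val_mul] at this
  rw [this, Ring.inverse_unit, mul_inv_rev]
  rfl

theorem ringInverse_mul' {R : Type*} [Ring R] {x y x' : R} (hy : IsUnit y) (h : x * x' = 1)
    (h' : x' * x = 1) :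
    Ring.inverse (y * x) = x' * Ring.inverse y := by
  obtain ⟨u, rfl⟩ := hy
  have := Ring.inverse_unit (u * ⟨x, x', h, h'⟩)
  rw [Units.val_mul] at this
  rw [this, Ring.inverse_unit, mul_inv_rev]
  rfl

theorem inverse_heckeT_simple_mul {w : W} {i : B} (h : ¬ cs.IsLeftDescent w i) :
    Ring.inverse (cs.heckeT (cs.simple i * w)⁻¹) =
      cs.heckeGenInv i * Ring.inverse (cs.heckeT w⁻¹) := by
  rw [mul_inv_rev, inv_simple, heckeT_mul_simple _ (by rwa [isRightDescent_inv_iff])]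
  exact ringInverse_mul' (cs.isUnit_heckeT _) (cs.heckeGen_mul_inv i) (cs.heckeGen_inv_mul i)

theorem inverse_heckeT_mul_simple {w : W} {i : B} (h : ¬ cs.IsRightDescent w i) :
    Ring.inverse (cs.heckeT (w * cs.simple i)⁻¹) =
      Ring.inverse (cs.heckeT w⁻¹) * cs.heckeGenInv i := by
  rw [mul_inv_rev, inv_simple, heckeT_simple_mul _ (by rwa [isLeftDescent_inv_iff])]
  exact ringInverse_mul (cs.isUnit_heckeT _) (cs.heckeGen_mul_inv i) (cs.heckeGen_inv_mul i)

/-- The bar involution takes left multiplication by `T_s` to left multiplication by `T_s⁻¹`. -/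
theorem heckeSumBar_heckeOp (i : B) (v : W →₀ ℤ[T;T⁻¹]) :
    cs.heckeSumBar (cs.heckeOp i v) = cs.heckeGenInv i * cs.heckeSumBar v := by
  induction v using Finsupp.induction_linear with
  | zero => simp [heckeSumBar_zero]
  | add f g hf hg => rw [map_add, heckeSumBar_add, hf, hg, heckeSumBar_add, mul_add]
  | single w c =>
    by_cases h : cs.IsLeftDescent w i
    · have h' := cs.isLeftDescent_iff_not_isLeftDescent_mul.1 h
      obtain ⟨z, rfl⟩ : ∃ z, w = cs.simple i * z := ⟨cs.simple i * w, by simp⟩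
      rw [simple_mul_simple_cancel_left] at h'
      rw [cs.heckeOp_single_of_isLeftDescent h, heckeSumBar_add, heckeSumBar_single,
        heckeSumBar_single, heckeSumBar_single, simple_mul_simple_cancel_left,
        cs.inverse_heckeT_simple_mul h', mul_smul_comm, ← mul_assoc, heckeGenInv_mul_self,
        add_mul, smul_mul_assoc, smul_mul_assoc, one_mul, smul_add, smul_smul, smul_smul]
      simp
    · rw [cs.heckeOp_single_of_not_isLeftDescent h, heckeSumBar_single, heckeSumBar_single,
        cs.inverse_heckeT_simple_mul h, mul_smul_comm]

/-- The bar involution takes right multiplication by `T_s` to right multiplication by `T_s⁻¹`. -/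
theorem heckeSumBar_heckeOpRight (i : B) (v : W →₀ ℤ[T;T⁻¹]) :
    cs.heckeSumBar (cs.heckeOpRight i v) = cs.heckeSumBar v * cs.heckeGenInv i := by
  induction v using Finsupp.induction_linear with
  | zero => simp [heckeSumBar_zero]
  | add f g hf hg => rw [map_add, heckeSumBar_add, hf, hg, heckeSumBar_add, add_mul]
  | single w c =>
    by_cases h : cs.IsRightDescent w i
    · have h' := cs.isRightDescent_iff_not_isRightDescent_mul.1 h
      obtain ⟨z, rfl⟩ : ∃ z, w = z * cs.simple i := ⟨w * cs.simple i, by simp⟩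
      rw [simple_mul_simple_cancel_right] at h'
      rw [cs.heckeOpRight_single_of_isRightDescent h, heckeSumBar_add, heckeSumBar_single,
        heckeSumBar_single, heckeSumBar_single, simple_mul_simple_cancel_right,
        cs.inverse_heckeT_mul_simple h', smul_mul_assoc, mul_assoc, heckeGenInv_mul_self,
        mul_add, mul_smul_comm, mul_smul_comm, mul_one, smul_add, smul_smul, smul_smul]
      simp
    · rw [cs.heckeOpRight_single_of_not_isRightDescent h, heckeSumBar_single, heckeSumBar_single,
        cs.inverse_heckeT_mul_simple h, smul_mul_assoc]

/-- The bar involution in coordinates with respect to the basis `(T_w)`. -/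
def barCoords (v : W →₀ ℤ[T;T⁻¹]) : W →₀ ℤ[T;T⁻¹] := cs.evalOne (cs.heckeSumBar v)

theorem barCoords_add (u v : W →₀ ℤ[T;T⁻¹]) :
    cs.barCoords (u + v) = cs.barCoords u + cs.barCoords v := by
  rw [barCoords, heckeSumBar_add, map_add]
  rfl

theorem barCoords_zero : cs.barCoords 0 = 0 := by
  rw [barCoords, heckeSumBar_zero, map_zero]

theorem barCoords_smul (c : ℤ[T;T⁻¹]) (v : W →₀ ℤ[T;T⁻¹]) :
    cs.barCoords (c • v) = invert c • cs.barCoords v := by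
  induction v using Finsupp.induction_linear with
  | zero => simp [barCoords_zero]
  | add f g hf hg => rw [smul_add, barCoords_add, hf, hg, barCoords_add, smul_add]
  | single w d =>
    rw [Finsupp.smul_single, barCoords, barCoords, heckeSumBar_single, heckeSumBar_single,
      smul_eq_mul, map_mul, mul_smul, map_smul]

/-- A length-changing involution whose operator `O` satisfies `bar (O v) = O⁻¹ (bar v)`, where
`O⁻¹ = q⁻¹ O + (q⁻¹ - 1)`. -/
structure IsBarStep (σ : W → W) : Prop extends cs.IsLengthStep σ where
  barCoords_stepOp : ∀ v, cs.barCoords (cs.stepOp σ v) =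
    (T (-1) : ℤ[T;T⁻¹]) • cs.stepOp σ (cs.barCoords v) +
      (T (-1) - 1 : ℤ[T;T⁻¹]) • cs.barCoords v

theorem isBarStep_simple_mul (i : B) : cs.IsBarStep (fun w => cs.simple i * w) where
  toIsLengthStep := cs.isLengthStep_simple_mul i
  barCoords_stepOp v := by
    rw [← heckeOp_eq_stepOp, barCoords, heckeSumBar_heckeOp, heckeGenInv, add_mul, map_add,
      smul_mul_assoc, smul_mul_assoc, map_smul, map_smul, one_mul, evalOne_gen_mul]
    rfl

theorem isBarStep_mul_simple (i : B) : cs.IsBarStep (fun w => w * cs.simple i) where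
  toIsLengthStep := cs.isLengthStep_mul_simple i
  barCoords_stepOp v := by
    change cs.barCoords (cs.heckeOpRight i v) = _
    rw [barCoords, heckeSumBar_heckeOpRight, heckeGenInv, mul_add, map_add,
      mul_smul_comm, mul_smul_comm, map_smul, map_smul, mul_one, evalOne_mul_gen]
    rfl

open Classical in
/-- The bar involution is triangular with respect to the length:
`bar (T_w) = q^{-ℓ(w)} T_w + (terms of smaller length)`. -/
theorem barCoords_single_apply {w z : W} (hz : cs.length w ≤ cs.length z) :
    cs.barCoords (Finsupp.single w 1) z = if z = w then T (-(cs.length w : ℤ)) else 0 := by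
  obtain ⟨n, hn⟩ : ∃ n, cs.length w = n := ⟨_, rfl⟩
  induction n generalizing w z with
  | zero =>
    rw [cs.length_eq_zero_iff.1 hn, barCoords, heckeSumBar_single, inv_one, heckeT_one]
    simp [evalOne_one, Finsupp.single_apply, eq_comm]
  | succ n ih =>
    have hw1 : w ≠ 1 := fun h => by simp [h] at hn
    obtain ⟨i, hi⟩ := cs.exists_leftDescent_of_ne_one hw1
    obtain ⟨x, rfl⟩ : ∃ x, w = cs.simple i * x := ⟨cs.simple i * w, by simp⟩
    have hx := cs.isLeftDescent_iff.1 hi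
    have hi' := cs.isLeftDescent_iff_not_isLeftDescent_mul.1 hi
    rw [simple_mul_simple_cancel_left] at hx hi'
    have hσ := cs.isBarStep_simple_mul i
    have hlen : cs.length x = n := by omega
    have hzx : z ≠ x := fun h => by rw [h] at hz; omega
    rw [← cs.heckeOp_single_of_not_isLeftDescent hi', heckeOp_eq_stepOp, hσ.barCoords_stepOp,
      Finsupp.add_apply, Finsupp.smul_apply, Finsupp.smul_apply, hσ.stepOp_apply,
      ih (w := x) (z := z) (by omega) hlen, if_neg hzx]
    have hstep := cs.length_simple_mul z i
    rw [ih (w := x) (z := cs.simple i * z) (by omega) hlen]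
    by_cases hzi : z = cs.simple i * x
    · subst hzi
      rw [simple_mul_simple_cancel_left, if_pos (by omega), if_pos rfl, if_pos rfl, ← hx]
      simp only [mul_zero, add_zero, smul_eq_mul, ← T_add]
      congr 1
      push_cast
      ring
    · have h1 : cs.simple i * z ≠ x := fun h => hzi (by rw [← h]; simp)
      simp [h1, hzi]

theorem barCoords_apply_of_length_le {v : W →₀ ℤ[T;T⁻¹]} {y : W}
    (h : ∀ x ∈ v.support, cs.length x ≤ cs.length y) :
    cs.barCoords v y = invert (v y) * T (-(cs.length y : ℤ)) := by
  classical
  induction v using Finsupp.induction with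
  | zero => simp [barCoords_zero]
  | single_add x c f hx hc ih =>
    have hsupp : (Finsupp.single x c + f).support = insert x f.support := by
      rw [Finsupp.support_single_add hx hc, Finset.cons_eq_insert]
    rw [hsupp] at h
    have h1 : cs.barCoords (Finsupp.single x c) y =
        invert (Finsupp.single x c y) * T (-(cs.length y : ℤ)) := by
      have h2 : Finsupp.single x c = c • Finsupp.single x (1 : ℤ[T;T⁻¹]) := by simp
      rw [h2, barCoords_smul, Finsupp.smul_apply,
        barCoords_single_apply _ (h x (Finset.mem_insert_self _ _))]
      by_cases hxy : y = x
      · subst hxy; simp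
      · simp [hxy]
    rw [barCoords_add, Finsupp.add_apply, Finsupp.add_apply, h1,
      ih fun z hz => h z (Finset.mem_insert_of_mem hz), map_add, add_mul]

/-! ### Descents and Kazhdan-Lusztig polynomials -/

/-- A nonzero polynomial of degree less than `n / 2` is not palindromic with respect to `n`. -/
theorem eq_zero_of_invert_toLaurent_mul {D : ℤ[X]} {n : ℕ} (hn : 2 * D.natDegree < n)
    (h : invert (toLaurent D) * T n = toLaurent D) : D = 0 := by
  by_contra hD
  have h1 : D.reverse * X ^ (n - D.natDegree) = D := by
    apply toLaurent_injective
    rw [map_mul, toLaurent_reverse, toLaurent_X_pow, mul_assoc, ← T_add]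
    conv_rhs => rw [← h]
    congr 2
    omega
  have h2 : D.reverse ≠ 0 := by rwa [Ne, reverse_eq_zero]
  have h3 := congrArg natDegree h1
  rw [natDegree_mul_X_pow _ h2] at h3
  omega

variable {cs} in
/-- The Kazhdan-Lusztig polynomials `P_{x,w}` and `P_{σ x,w}` agree if `σ w < w`. With
`C = ∑ P_{y,w} T_y`, the element `E = (T_s - q) C` has the coefficients `P_{σ y,w} - P_{y,w}` up to
a power of `q`, and `bar E = q^{-ℓ(w)-1} E`. By triangularity the coefficient of `E` at a longest
element of its support is a palindromic polynomial, contrary to the degree bound. -/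
theorem IsKLFamily.apply_step_eq {σ : W → W} (hσ : cs.IsBarStep σ) {w : W} {p : W →₀ ℤ[X]}
    (hp : cs.IsKLFamily w p) (hw : cs.length (σ w) < cs.length w) (x : W) :
    p (σ x) = p x := by
  set C := p.mapRange Polynomial.toLaurent (map_zero _) with hC
  have hCx (x : W) : C x = toLaurent (p x) := by simp [hC]
  have hbarC : cs.barCoords C = (T (-(cs.length w : ℤ)) : ℤ[T;T⁻¹]) • C := by
    rw [barCoords, hp.bar_invariant, map_smul, evalOne_heckeSum]
  set E := cs.stepOp σ C + (- T 1 : ℤ[T;T⁻¹]) • C with hE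
  have hbarE : cs.barCoords E = (T (-(cs.length w : ℤ) - 1) : ℤ[T;T⁻¹]) • E := by
    rw [hE, barCoords_add, hσ.barCoords_stepOp, barCoords_smul, hbarC, map_smul, map_neg,
      invert_T, T_sub]
    have h := T_neg_one_mul_T_one
    ext1 z
    simp only [Finsupp.add_apply, Finsupp.smul_apply, smul_eq_mul]
    linear_combination (T (-(cs.length w : ℤ)) * C z) * h
  have hE1 {z : W} (hz : cs.length (σ z) < cs.length z) : E z = C (σ z) - C z := by
    rw [hE, Finsupp.add_apply, hσ.stepOp_apply, if_pos hz, Finsupp.smul_apply, smul_eq_mul]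
    ring
  have hE2 {z : W} (hz : ¬ cs.length (σ z) < cs.length z) : E z = T 1 * (C (σ z) - C z) := by
    rw [hE, Finsupp.add_apply, hσ.stepOp_apply, if_neg hz, Finsupp.smul_apply, smul_eq_mul]
    ring
  have hE0 : E = 0 := by
    by_contra hne
    obtain ⟨y, hy, hmax⟩ := Finset.exists_max_image E.support cs.length
      (Finsupp.support_nonempty_iff.2 hne)
    have hEy : E y ≠ 0 := Finsupp.mem_support_iff.1 hy
    have hdesc : cs.length (σ y) < cs.length y := by
      by_contra hlt
      have h1 := hE1 ((hσ.length_lt_iff y).2 hlt)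
      rw [hσ.invol] at h1
      have h2 : E (σ y) ≠ 0 := by
        intro h0
        apply hEy
        rw [hE2 hlt, ← neg_sub, ← h1, h0]
        simp
      have := hmax _ (Finsupp.mem_support_iff.2 h2)
      have := hσ.length_step y
      omega
    have hstep := hσ.length_step y
    set D := p (σ y) - p y with hD
    have hED : E y = toLaurent D := by rw [hE1 hdesc, hCx, hCx, hD, map_sub]
    have hDne : D ≠ 0 := fun h => hEy (by rw [hED, h, map_zero])
    have hσy : σ y ≠ w := by
      intro h
      have h1 : σ w = y := by rw [← h, hσ.invol]
      rw [h1, ← h] at hw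
      omega
    -- the bounds on the two terms of `D`; outside of the Bruhat interval both vanish
    have hdeg1 : p (σ y) = 0 ∨ 2 * (p (σ y)).natDegree + cs.length y ≤ cs.length w := by
      by_cases hle : cs.BruhatLE (σ y) w
      · have := hp.degree_le _ hle hσy
        right; omega
      · exact Or.inl (hp.eq_zero_of_not_le _ hle)
    have hdeg2 : p y = 0 ∨ 2 * (p y).natDegree + cs.length y ≤ cs.length w := by
      by_cases hle : cs.BruhatLE y w
      · by_cases hyw : y = w
        · right; simp [hyw, hp.self]
        · have := hp.degree_le _ hle hyw
          right; omega
      · exact Or.inl (hp.eq_zero_of_not_le _ hle)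
    have hdegD : 2 * D.natDegree + cs.length y ≤ cs.length w := by
      rcases hdeg1 with h1 | h1 <;> rcases hdeg2 with h2 | h2
      · exact absurd (by rw [hD, h1, h2, sub_zero]) hDne
      · simpa [hD, h1] using h2
      · simpa [hD, h2] using h1
      · have := natDegree_sub_le (p (σ y)) (p y)
        rw [← hD] at this
        omega
    have htop := cs.barCoords_apply_of_length_le (v := E) (y := y) hmax
    rw [hbarE, Finsupp.smul_apply, smul_eq_mul, hED] at htop
    refine hDne (eq_zero_of_invert_toLaurent_mul (n := cs.length w + 1 - cs.length y)
      (by omega) ?_)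
    calc invert (toLaurent D) * T ((cs.length w + 1 - cs.length y : ℕ) : ℤ)
        = (invert (toLaurent D) * T (-(cs.length y : ℤ))) * T (cs.length w + 1 : ℤ) := by
          rw [mul_assoc, ← T_add]
          congr 2
          omega
      _ = toLaurent D := by
          rw [← htop, mul_right_comm, ← T_add]
          simp
  have hx : E x = 0 := by rw [hE0]; rfl
  apply toLaurent_injective
  rw [← hCx, ← hCx, ← sub_eq_zero]
  by_cases hlt : cs.length (σ x) < cs.length x
  · rwa [← hE1 hlt]
  · rw [hE2 hlt] at hx
    exact (isUnit_T 1).mul_right_eq_zero.1 hx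

/-- If `μ(u, v) ≠ 0` and `σ v < v`, `σ u > u`, then `v = σ u`. -/
theorem step_eq_of_klMu_ne_zero {σ : W → W} (hσ : cs.IsBarStep σ) {u v : W}
    (hμ : cs.klMu u v ≠ 0) (hv : cs.length (σ v) < cs.length v)
    (hu : ¬ cs.length (σ u) < cs.length u) : σ u = v := by
  classical
  rw [klMu, Ne, ite_eq_right_iff, Classical.not_imp] at hμ
  obtain ⟨⟨hle, k, hk⟩, hcoeff⟩ := hμ
  have hex : ∃ p : W →₀ ℤ[X], cs.IsKLFamily v p := by
    by_contra hex
    rw [klPoly, dif_neg hex] at hcoeff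
    simp at hcoeff
  rw [klPoly, dif_pos hex] at hcoeff
  have hp := hex.choose_spec
  by_contra hne
  have heq := hp.apply_step_eq hσ hv u
  have hle' : cs.BruhatLE (σ u) v := by
    by_contra hnle
    rw [← heq, hp.eq_zero_of_not_le _ hnle] at hcoeff
    simp at hcoeff
  have hdeg := hp.degree_le _ hle' hne
  have h1 := le_natDegree_of_ne_zero hcoeff
  rw [heq] at hdeg
  have := hσ.length_step u
  omega

theorem klMu_ne_zero_or_of_klMuTilde_pos {u v : W} (h : 0 < cs.klMuTilde u v) :
    cs.klMu u v ≠ 0 ∨ cs.klMu v u ≠ 0 := by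
  rw [klMuTilde] at h
  split_ifs at h
  · exact Or.inl h.ne'
  · exact Or.inr h.ne'
  · exact absurd h (lt_irrefl _)

/-- Multiplication by `t` on the right does not remove left descents when it increases the
length. -/
theorem IsLeftDescent.mul_simple {w : W} {i j : B} (hi : cs.IsLeftDescent w i)
    (hj : ¬ cs.IsRightDescent w j) : cs.IsLeftDescent (w * cs.simple j) i := by
  have h1 := cs.isLeftDescent_iff.1 hi
  have h2 := cs.not_isRightDescent_iff.1 hj
  have h3 := cs.length_mul_simple (cs.simple i * w) j
  rw [IsLeftDescent, ← mul_assoc]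
  omega

theorem IsRightDescent.simple_mul {w : W} {i j : B} (hj : cs.IsRightDescent w j)
    (hi : ¬ cs.IsLeftDescent w i) : cs.IsRightDescent (cs.simple i * w) j := by
  have h1 := cs.isRightDescent_iff.1 hj
  have h2 := cs.not_isLeftDescent_iff.1 hi
  have h3 := cs.length_simple_mul (w * cs.simple j) i
  rw [IsRightDescent, mul_assoc]
  omega

/-- One elementary step of the right preorder shrinks the left descent set. -/
theorem leftTau_subset_of_klMuTilde_pos {u v : W} (hμ : 0 < cs.klMuTilde u v)
    (hτ : ¬ cs.rightTau u ⊆ cs.rightTau v) : cs.leftTau v ⊆ cs.leftTau u := by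
  obtain ⟨j, hju, hjv⟩ := Set.not_subset.1 hτ
  rcases cs.klMu_ne_zero_or_of_klMuTilde_pos hμ with h | h
  · intro i hi
    by_contra hiu
    have huv := cs.step_eq_of_klMu_ne_zero (cs.isBarStep_simple_mul i) h hi hiu
    exact hjv (huv ▸ IsRightDescent.simple_mul cs hju hiu)
  · have hvu := cs.step_eq_of_klMu_ne_zero (cs.isBarStep_mul_simple j) h hju hjv
    intro i hi
    exact hvu ▸ IsLeftDescent.mul_simple cs hi hjv

theorem RightKLLE.leftTau_subset {x y : W} (h : cs.RightKLLE x y) :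
    cs.leftTau y ⊆ cs.leftTau x := by
  induction h with
  | refl => exact subset_rfl
  | tail _ h ih => exact (cs.leftTau_subset_of_klMuTilde_pos h.1 h.2).trans ih

/-! ### Order preserving maps and cells -/

theorem RightKLEquiv.symm {x y : W} (h : cs.RightKLEquiv x y) : cs.RightKLEquiv y x :=
  ⟨h.2, h.1⟩

/-- An order preserving map takes equivalent elements to sets whose elements are pairwise
equivalent: for sets of equal size, following the two matchings `T(x) → T(y) → T(x)` permutes the
finite set `T(x)`, so that every `a ∈ T(x)` lies on a cycle `a ≤ b ≤ ⋯ ≤ a`. -/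
theorem IsRightKLOrderPreserving.exists_rightKLEquiv {T : PartialSetMap W}
    (hT : cs.IsRightKLOrderPreserving T) {x y : T.dom} (hxy : cs.RightKLEquiv x y)
    (hfin : (T.toFun x).Finite) (hne : (T.toFun y).Nonempty) {a : W} (ha : a ∈ T.toFun x) :
    ∃ b ∈ T.toFun y, cs.RightKLEquiv a b := by
  obtain ⟨h1, h1'⟩ := hT x y hxy.1
  obtain ⟨h2, h2'⟩ := hT y x hxy.2
  by_cases hcard : (T.toFun x).encard = (T.toFun y).encard
  · have hk : (T.toFun x).encard = (T.toFun x).ncard := hfin.cast_ncard_eq.symm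
    have hinj {n : ℕ} {S : Set W} (hS : S.encard = n) {f : Fin n → W} (hf : Set.range f = S) :
        Function.Injective f := by
      have h3 : (Set.univ : Set (Fin n)).InjOn f := by
        refine Set.finite_univ.injOn_of_encard_image_eq ?_
        rw [Set.image_univ, hf, hS]
        simp
      exact Set.injOn_univ.1 h3
    obtain ⟨f, g, hf, hg, hfg⟩ := h1 _ hk (hcard ▸ hk)
    obtain ⟨g', f', hg', hf', hgf⟩ := h2 _ (hcard ▸ hk) hk
    have hf_inj := hinj hk hf
    have hf'_inj := hinj hk hf'
    have hg_inj := hinj (hcard ▸ hk) hg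
    -- `g i = g' (α i)` and `f' i = f (β i)`
    have hα : ∀ i, ∃ k, g' k = g i := fun i => by
      have : g i ∈ Set.range g' := by rw [hg', ← hg]; exact Set.mem_range_self i
      exact this
    have hβ : ∀ i, ∃ k, f k = f' i := fun i => by
      have : f' i ∈ Set.range f := by rw [hf, ← hf']; exact Set.mem_range_self i
      exact this
    choose α hα using hα
    choose β hβ using hβ
    have hα_inj : Function.Injective α := fun i k h => hg_inj (by rw [← hα, ← hα, h])
    have hβ_inj : Function.Injective β := fun i k h => hf'_inj (by rw [← hβ, ← hβ, h])
    have hle (i) : cs.RightKLLE (g i) (f (β (α i))) := by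
      rw [hβ, ← hα]; exact hgf _
    have hiter (i) (n : ℕ) : cs.RightKLLE (f i) (f ((β ∘ α)^[n] i)) := by
      induction n with
      | zero => exact Relation.ReflTransGen.refl
      | succ n ih =>
        rw [Function.iterate_succ_apply']
        exact ih.trans ((hfg _).trans (hle _))
    obtain ⟨i, rfl⟩ : a ∈ Set.range f := by rw [hf]; exact ha
    refine ⟨g i, hg ▸ Set.mem_range_self i, hfg i, ?_⟩
    have hper : i ∈ Function.periodicPts (β ∘ α) :=
      Function.Injective.mem_periodicPts (hβ_inj.comp hα_inj) i
    obtain ⟨n, hn, hn'⟩ := hper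
    obtain ⟨m, rfl⟩ := Nat.exists_eq_succ_of_ne_zero hn.ne'
    have h3 := hiter (β (α i)) m
    have h4 : (β ∘ α)^[m] (β (α i)) = i := hn'
    rw [h4] at h3
    exact (hle i).trans h3
  · obtain ⟨b, hb⟩ := hne
    exact ⟨b, hb, h1' hcard a ha b hb, h2' (Ne.symm hcard) b hb a ha⟩

end CoxeterSystem

end

theorem mainTheorem4 {B : Type*} {W : Type*} [Group W] {M : CoxeterMatrix B}
    (cs : CoxeterSystem M W) (F : Set (PartialSetMap W))
    (hfin : ∀ T ∈ F, ∀ x : T.dom, (T.toFun x).Finite)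
    (hne : ∀ T ∈ F, ∀ x : T.dom, (T.toFun x).Nonempty)
    (hord : ∀ T ∈ F, cs.IsRightKLOrderPreserving T)
    (hdom : ∀ T ∈ F, cs.IsRightKLIntervalSet T.dom)
    (x y : W) (hxy : cs.RightKLEquiv x y) :
    cs.SameLeftGenTau F x y := by
  intro n
  induction n generalizing x y with
  | zero =>
    exact (CoxeterSystem.RightKLLE.leftTau_subset cs hxy.2).antisymm
      (CoxeterSystem.RightKLLE.leftTau_subset cs hxy.1)
  | succ n ih =>
    have key (x y : W) (hxy : cs.RightKLEquiv x y) : ∀ T ∈ F, ∀ hx : x ∈ T.dom,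
        ∃ hy : y ∈ T.dom, ∀ a ∈ T.toFun ⟨x, hx⟩, ∃ b ∈ T.toFun ⟨y, hy⟩,
          cs.LeftGenTauEquiv F n a b := by
      intro T hT hx
      have hy : y ∈ T.dom := hdom T hT x hx x hx y hxy.1 hxy.2
      refine ⟨hy, fun a ha => ?_⟩
      obtain ⟨b, hb, hab⟩ := CoxeterSystem.IsRightKLOrderPreserving.exists_rightKLEquiv cs
        (hord T hT) (x := ⟨x, hx⟩) (y := ⟨y, hy⟩) hxy (hfin T hT _) (hne T hT _) ha
      exact ⟨b, hb, ih a b hab⟩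
    exact ⟨ih x y hxy, key x y hxy, key y x (CoxeterSystem.RightKLEquiv.symm cs hxy)⟩
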